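/- Let $N=(0,0,1)$, $S=(0,0,-1)$ be the poles of the unit sphere $\mathbb S^2\subset\mathbb R^3$, and let $T^1\mathbb S^2\cong\mathbb{RP}^3$ be its unit tangent bundle with the Sasaki metric. On $\mathbb S^2\setminus\{N,S\}$ consider the orthonormal frame $$\vec e_1=\tfrac{1}{\sqrt{x^2+y^2}}(-y,x,0),\qquad \vec e_2=\Bigl(\tfrac{xz}{\sqrt{x^2+y^2}},\tfrac{yz}{\sqrt{x^2+y^2}},-\sqrt{x^2+y^2}\Bigr),$$ and, for an integer $k$, the unit vector field $$\vec v_k=\cos((k-1)\beta)\,\vec e_1+\sin((k-1)\beta)\,\vec e_2,$$ where $\beta$ is the longitude, $(x,y)=\sqrt{x^2+y^2}\,(\cos\beta,\sin\beta)$. Regard $\vec v_k$ as a section of $T^1\mathbb S^2$ over $\mathbb S^2\setminus\{N,S\}$. Theorem. Let $k>2$ be even. Let $K$ be the Klein bottle, the quotient of $\mathbb R^2$ by the group generated by $(x,y)\mapsto(x+1,y)$ and $(x,y)\mapsto(-x,y+1)$; it is the union of the two closed Möbius bands $M_+$ and $M_-$, the images of $[-\frac14,\frac14]\times\mathbb R$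 and of $[\frac14,\frac34]\times\mathbb R$, glued along their common boundary circle. Then there is a smooth immersion $f:K\to T^1\mathbb S^2$ with mean curvature zero everywhere such that $$f(K)=\overline{\vec v_k(\mathbb S^2\setminus\{N,S\})},\qquad f(M_+)=\overline{\vec v_k(\mathbb S^2_+\setminus\{N\})},\qquad f(M_-)=\overline{\vec v_k(\mathbb S^2_-\setminus\{S\})},$$ where $\mathbb S^2_\pm$ are the closed hemispheres $\{z\ge0\}$ and $\{z\le0\}$. -/

import Mathlib

open scoped ContDiff Topology

noncomputable section

namespace KleinField

/-! ### The unit tangent bundle of the sphere and its Sasaki metric -/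

/-- Euclidean three-space. -/
abbrev E3 : Type := EuclideanSpace ℝ (Fin 3)

/-- The north pole. -/
def northPole : E3 := !₂[0, 0, 1]

/-- The south pole. -/
def southPole : E3 := !₂[0, 0, -1]

/-- The unit tangent bundle of the unit sphere, as the embedded three-dimensional submanifold of
`ℝ³ × ℝ³` consisting of the pairs `(p, v)` with `|p| = 1`, `|v| = 1` and `v ⟂ p`. -/
def unitTangentSet : Set (E3 × E3) :=
  {q | ‖q.1‖ = 1 ∧ ‖q.2‖ = 1 ∧ inner ℝ q.1 q.2 = 0}

/-- The unit tangent bundle as a topological space (with the subspace topology). -/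
abbrev UnitTangentSphere : Type := unitTangentSet

/-- The Sasaki metric at `q = (p, v)`. A tangent vector `(a, b)` at `q` has horizontal part `a` and
vertical part the covariant derivative `b - ⟨p, b⟩ p` (the component of `b` tangent to the sphere);
the Sasaki metric is the sum of the Euclidean products of the two parts. -/
def sasaki (q w w' : E3 × E3) : ℝ :=
  inner ℝ w.1 w'.1 +
    inner ℝ (w.2 - (inner ℝ q.1 w.2 : ℝ) • q.1) (w'.2 - (inner ℝ q.1 w'.2 : ℝ) • q.1)

/-! ### The vector fields -/

/-- The sphere without its two poles. -/
abbrev PuncturedSphere : Type :=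
  {p : E3 // p ∈ Metric.sphere (0 : E3) 1 \ {northPole, southPole}}

/-- The unit field tangent to the parallels. -/
def e₁ (p : E3) : E3 :=
  (1 / √(p 0 ^ 2 + p 1 ^ 2)) • !₂[-p 1, p 0, 0]

/-- The unit field tangent to the meridians. -/
def e₂ (p : E3) : E3 :=
  !₂[p 0 * p 2 / √(p 0 ^ 2 + p 1 ^ 2), p 1 * p 2 / √(p 0 ^ 2 + p 1 ^ 2), -√(p 0 ^ 2 + p 1 ^ 2)]

/-- The longitude of a point: the argument of `x + i y`. -/
def longitude (p : E3) : ℝ := Complex.arg ⟨p 0, p 1⟩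

/-- The field `v_k = cos((k-1)β) e₁ + sin((k-1)β) e₂`, where `β` is the longitude. -/
def field (k : ℕ) (p : E3) : E3 :=
  Real.cos (((k : ℝ) - 1) * longitude p) • e₁ p + Real.sin (((k : ℝ) - 1) * longitude p) • e₂ p

theorem field_mem (k : ℕ) (p : PuncturedSphere) : ((p : E3), field k p) ∈ unitTangentSet := by
  obtain ⟨p, hp, hne⟩ := p
  have h1 : ‖p‖ = 1 := by simpa using hp
  have hs : p 0 ^ 2 + p 1 ^ 2 + p 2 ^ 2 = 1 := by
    have := EuclideanSpace.real_norm_sq_eq p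
    rw [h1, Fin.sum_univ_three] at this
    linarith
  have hpos : 0 < p 0 ^ 2 + p 1 ^ 2 := by
    rcases (add_nonneg (sq_nonneg (p 0)) (sq_nonneg (p 1))).lt_or_eq with h | h
    · exact h
    · exfalso
      apply hne
      have h0 : p 0 = 0 := by nlinarith [sq_nonneg (p 0), sq_nonneg (p 1)]
      have h1 : p 1 = 0 := by nlinarith [sq_nonneg (p 0), sq_nonneg (p 1)]
      have h2 : (p 2 - 1) * (p 2 + 1) = 0 := by rw [h0, h1] at hs; linarith
      rcases mul_eq_zero.1 h2 with h2 | h2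
      · left
        ext i
        fin_cases i
        · simpa [northPole] using h0
        · simpa [northPole] using h1
        · simp [northPole]; linarith
      · right
        ext i
        fin_cases i
        · simpa [southPole] using h0
        · simpa [southPole] using h1
        · simp [southPole]; linarith
  set ρ := √(p 0 ^ 2 + p 1 ^ 2) with hρ
  have hρ0 : 0 < ρ := Real.sqrt_pos.2 hpos
  have hρ2 : ρ ^ 2 = p 0 ^ 2 + p 1 ^ 2 := Real.sq_sqrt hpos.le
  set t := ((k : ℝ) - 1) * longitude p
  have hcs := Real.sin_sq_add_cos_sq t
  refine ⟨h1, ?_, ?_⟩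
  · have : ‖field k p‖ ^ 2 = 1 := by
      rw [EuclideanSpace.real_norm_sq_eq, Fin.sum_univ_three]
      simp [field, e₁, e₂, ← hρ]
      have e : ∀ c s : ℝ, (-(c * (ρ⁻¹ * p 1)) + s * (p 0 * p 2 / ρ)) ^ 2 +
          (c * (ρ⁻¹ * p 0) + s * (p 1 * p 2 / ρ)) ^ 2 + (s * ρ) ^ 2 =
          (c ^ 2 * (p 0 ^ 2 + p 1 ^ 2) + s ^ 2 * ((p 0 ^ 2 + p 1 ^ 2) * p 2 ^ 2)) / ρ ^ 2
            + s ^ 2 * ρ ^ 2 := by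
        intro c s
        field_simp
        ring
      have e' := e (Real.cos t) (Real.sin t)
      rw [← hρ2] at e' hs
      have : (Real.cos t ^ 2 * ρ ^ 2 + Real.sin t ^ 2 * (ρ ^ 2 * p 2 ^ 2)) / ρ ^ 2 =
          Real.cos t ^ 2 + Real.sin t ^ 2 * p 2 ^ 2 := by field_simp
      rw [this] at e'
      rw [e']
      nlinarith
    nlinarith [norm_nonneg (field k p)]
  · simp only [PiLp.inner_apply, Fin.sum_univ_three]
    simp [field, e₁, e₂, ← hρ]
    field_simp
    rw [hρ2]
    ring

/-- The field `v_k` as a section of the unit tangent bundle over the punctured sphere. -/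
def section_ (k : ℕ) (p : PuncturedSphere) : UnitTangentSphere := ⟨(p, field k p), field_mem k p⟩

/-! ### The Klein bottle and the two Möbius bands in it -/

theorem neg_one_zpow_mul_self (n : ℤ) : (-1 : ℝ) ^ n * (-1) ^ n = 1 := by
  rw [← mul_zpow]; simp

/-- The orbit relation on `ℝ²` of the group generated by the isometries `(x, y) ↦ (x + 1, y)` and
`(x, y) ↦ (-x, y + 1)`. -/
def kleinSetoid : Setoid (ℝ × ℝ) where
  r a b := ∃ m n : ℤ, b.1 = (-1) ^ n * a.1 + m ∧ b.2 = a.2 + n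
  iseqv :=
    { refl := fun a => ⟨0, 0, by simp, by simp⟩
      symm := by
        rintro a b ⟨m, n, h1, h2⟩
        rcases Int.even_or_odd n with hn | hn
        · refine ⟨-m, -n, ?_, by push_cast; linarith⟩
          rw [hn.neg_one_zpow] at h1
          rw [hn.neg.neg_one_zpow]; push_cast; linarith
        · refine ⟨m, -n, ?_, by push_cast; linarith⟩
          rw [hn.neg_one_zpow] at h1
          rw [hn.neg.neg_one_zpow]; linarith
      trans := by
        rintro a b c ⟨m, n, h1, h2⟩ ⟨m', n', h1', h2'⟩
        have hne : (-1 : ℝ) ≠ 0 := by norm_num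
        rcases Int.even_or_odd n' with hn | hn
        · refine ⟨m + m', n + n', ?_, by push_cast; linarith⟩
          rw [h1', h1, zpow_add₀ hne, hn.neg_one_zpow]; push_cast; ring
        · refine ⟨-m + m', n + n', ?_, by push_cast; linarith⟩
          rw [h1', h1, zpow_add₀ hne, hn.neg_one_zpow]; push_cast; ring }

/-- The Klein bottle: the quotient of the plane by the free and properly discontinuous action of
the group generated by `(x, y) ↦ (x + 1, y)` and `(x, y) ↦ (-x, y + 1)`. -/
def KleinBottle : Type := Quotient kleinSetoid

instance : TopologicalSpace KleinBottle := inferInstanceAs (TopologicalSpace (Quotient kleinSetoid))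

/-- The universal covering `ℝ² → KleinBottle`. The deck transformations are affine isometries, and
the smooth structure of the Klein bottle is the one for which this is a local diffeomorphism. -/
def KleinBottle.mk (a : ℝ × ℝ) : KleinBottle := Quotient.mk kleinSetoid a

/-- The strip `[-1/4, 1/4] × ℝ`. -/
abbrev Strip : Type := {a : ℝ × ℝ // |a.1| ≤ 1 / 4}

/-- The orbit relation of the glide reflection `(x, y) ↦ (-x, y + 1)` on the strip. -/
def mobiusSetoid : Setoid Strip where
  r a b := ∃ n : ℤ, b.1.1 = (-1) ^ n * a.1.1 ∧ b.1.2 = a.1.2 + n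
  iseqv :=
    { refl := fun a => ⟨0, by simp, by simp⟩
      symm := by
        rintro a b ⟨n, h1, h2⟩
        refine ⟨-n, ?_, by push_cast; linarith⟩
        rw [h1, ← mul_assoc, ← zpow_add₀ (by norm_num)]; simp
      trans := by
        rintro a b c ⟨n, h1, h2⟩ ⟨n', h1', h2'⟩
        refine ⟨n + n', ?_, by push_cast; linarith⟩
        rw [h1', h1, zpow_add₀ (by norm_num)]; ring }

/-- The closed Möbius band: the strip `[-1/4, 1/4] × ℝ` modulo `(x, y) ↦ (-x, y + 1)`. -/
def MobiusBand : Type := Quotient mobiusSetoid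

instance : TopologicalSpace MobiusBand := inferInstanceAs (TopologicalSpace (Quotient mobiusSetoid))

/-- The boundary circle of the Möbius band. -/
def MobiusBand.boundary : Set MobiusBand :=
  {b | ∃ a : Strip, |a.1.1| = 1 / 4 ∧ Quotient.mk mobiusSetoid a = b}

/-- The first Möbius band in the Klein bottle, `[x, y] ↦ [x, y]`. -/
def MobiusBand.incl₁ : MobiusBand → KleinBottle :=
  Quotient.lift (fun a : Strip => KleinBottle.mk a.1) (by
    rintro a b ⟨n, h1, h2⟩
    exact Quotient.sound ⟨0, n, by simpa using h1, h2⟩)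

/-- The second Möbius band in the Klein bottle, `[x, y] ↦ [x + 1/2, y]`. -/
def MobiusBand.incl₂ : MobiusBand → KleinBottle :=
  Quotient.lift (fun a : Strip => KleinBottle.mk (a.1.1 + 1 / 2, a.1.2)) (by
    rintro a b ⟨n, h1, h2⟩
    rcases Int.even_or_odd n with hn | hn
    · refine Quotient.sound ⟨0, n, ?_, h2⟩
      rw [hn.neg_one_zpow] at h1 ⊢; push_cast; linarith
    · refine Quotient.sound ⟨1, n, ?_, h2⟩
      rw [hn.neg_one_zpow] at h1 ⊢; push_cast; linarith)

theorem MobiusBand.incl₁_injective : Function.Injective MobiusBand.incl₁ := by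
  rintro ⟨a, ha⟩ ⟨b, hb⟩ h
  obtain ⟨m, n, h1, h2⟩ := Quotient.exact h
  dsimp only at h1 h2
  have ha' := abs_le.1 ha
  have hb' := abs_le.1 hb
  have hm : m = 0 := by
    rcases Int.even_or_odd n with hn | hn <;> rw [hn.neg_one_zpow] at h1
    · have l : (m : ℝ) < 1 := by linarith
      have r : (-1 : ℝ) < m := by linarith
      have l' : m < 1 := by exact_mod_cast l
      have r' : -1 < m := by exact_mod_cast r
      omega
    · have l : (m : ℝ) < 1 := by linarith
      have r : (-1 : ℝ) < m := by linarith
      have l' : m < 1 := by exact_mod_cast l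
      have r' : -1 < m := by exact_mod_cast r
      omega
  subst hm
  exact Quotient.sound ⟨n, by simpa using h1, h2⟩

theorem MobiusBand.incl₂_injective : Function.Injective MobiusBand.incl₂ := by
  rintro ⟨a, ha⟩ ⟨b, hb⟩ h
  obtain ⟨m, n, h1, h2⟩ := Quotient.exact h
  dsimp only at h1 h2
  have ha' := abs_le.1 ha
  have hb' := abs_le.1 hb
  rcases Int.even_or_odd n with hn | hn
  · have h1' := h1
    rw [hn.neg_one_zpow] at h1'
    have l : (m : ℝ) < 1 := by linarith
    have r : (-1 : ℝ) < m := by linarith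
    have l' : m < 1 := by exact_mod_cast l
    have r' : -1 < m := by exact_mod_cast r
    have hm : m = 0 := by omega
    refine Quotient.sound ⟨n, ?_, h2⟩
    rw [hn.neg_one_zpow]; rw [hm] at h1'; push_cast at h1'; linarith
  · have h1' := h1
    rw [hn.neg_one_zpow] at h1'
    have l : (m : ℝ) < 2 := by linarith
    have r : (0 : ℝ) < m := by linarith
    have l' : m < 2 := by exact_mod_cast l
    have r' : 0 < m := by exact_mod_cast r
    have hm : m = 1 := by omega
    refine Quotient.sound ⟨n, ?_, h2⟩
    rw [hn.neg_one_zpow]; rw [hm] at h1'; push_cast at h1'; linarith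

/-- The Klein bottle is the union of the two Möbius bands. -/
theorem MobiusBand.range_union :
    Set.range MobiusBand.incl₁ ∪ Set.range MobiusBand.incl₂ = Set.univ := by
  refine Set.eq_univ_of_forall ?_
  rintro ⟨x, y⟩
  have h1 := Int.floor_le (x + 1 / 4)
  have h2 := Int.lt_floor_add_one (x + 1 / 4)
  set m := ⌊x + 1 / 4⌋
  by_cases h : x - m ≤ 1 / 4
  · left
    refine ⟨Quotient.mk mobiusSetoid ⟨(x - m, y), abs_le.2 ⟨by dsimp only; linarith, h⟩⟩, ?_⟩
    exact Quotient.sound ⟨m, 0, by simp, by simp⟩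
  · right
    refine ⟨Quotient.mk mobiusSetoid ⟨(x - m - 1 / 2, y),
      abs_le.2 ⟨by dsimp only; linarith, by dsimp only; linarith⟩⟩, ?_⟩
    exact Quotient.sound ⟨m, 0, by simp, by simp⟩

/-- The two Möbius bands meet exactly along their common boundary circle. -/
theorem MobiusBand.range_inter :
    Set.range MobiusBand.incl₁ ∩ Set.range MobiusBand.incl₂ = incl₁ '' boundary ∧
      incl₁ '' boundary = incl₂ '' boundary := by
  have A : incl₁ '' boundary ⊆ incl₂ '' boundary := by
    rintro _ ⟨_, ⟨⟨a, ha⟩, hb, rfl⟩, rfl⟩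
    dsimp only at hb
    rcases (abs_eq (by norm_num)).1 hb with h | h
    · refine ⟨_, ⟨⟨(-(1 / 4), a.2), by norm_num⟩, by norm_num, rfl⟩, ?_⟩
      exact Quotient.sound ⟨0, 0, by norm_num [h], by simp⟩
    · refine ⟨_, ⟨⟨(1 / 4, a.2), by norm_num⟩, by norm_num, rfl⟩, ?_⟩
      exact Quotient.sound ⟨-1, 0, by norm_num [h], by simp⟩
  have B : incl₂ '' boundary ⊆ incl₁ '' boundary := by
    rintro _ ⟨_, ⟨⟨a, ha⟩, hb, rfl⟩, rfl⟩
    dsimp only at hb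
    rcases (abs_eq (by norm_num)).1 hb with h | h
    · refine ⟨_, ⟨⟨(-(1 / 4), a.2), by norm_num⟩, by norm_num, rfl⟩, ?_⟩
      exact Quotient.sound ⟨1, 0, by norm_num [h], by simp⟩
    · refine ⟨_, ⟨⟨(1 / 4, a.2), by norm_num⟩, by norm_num, rfl⟩, ?_⟩
      exact Quotient.sound ⟨0, 0, by norm_num [h], by simp⟩
  refine ⟨Set.Subset.antisymm ?_ ?_, Set.Subset.antisymm A B⟩
  · rintro _ ⟨⟨⟨a, ha⟩, rfl⟩, ⟨⟨b, hb⟩, h⟩⟩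
    refine ⟨_, ⟨⟨a, ha⟩, ?_, rfl⟩, rfl⟩
    obtain ⟨m, n, h1, h2⟩ := Quotient.exact h
    dsimp only at h1 h2 ⊢
    have ha' := abs_le.1 ha
    have hb' := abs_le.1 hb
    rw [abs_eq (by norm_num)]
    rcases Int.even_or_odd n with hn | hn <;> rw [hn.neg_one_zpow] at h1
    · have l : (m : ℝ) < 1 := by linarith
      have r : (-2 : ℝ) < m := by linarith
      have l' : m < 1 := by exact_mod_cast l
      have r' : -2 < m := by exact_mod_cast r
      have hm : m = 0 ∨ m = -1 := by omega
      rcases hm with hm | hm <;> rw [hm] at h1 <;> push_cast at h1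
      · left; linarith
      · right; linarith
    · have l : (m : ℝ) < 2 := by linarith
      have r : (-1 : ℝ) < m := by linarith
      have l' : m < 2 := by exact_mod_cast l
      have r' : -1 < m := by exact_mod_cast r
      have hm : m = 0 ∨ m = 1 := by omega
      rcases hm with hm | hm <;> rw [hm] at h1 <;> push_cast at h1
      · right; linarith
      · left; linarith
  · intro z hz
    obtain ⟨w, _, rfl⟩ := A hz
    obtain ⟨w', _, h'⟩ := hz
    exact ⟨⟨w', h'⟩, ⟨w, rfl⟩⟩

/-! ### Immersions and mean curvature -/

/-- A map from the Klein bottle to the unit tangent bundle is a smooth immersion if its lift to the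
plane, as a map into the ambient vector space of the submanifold, is smooth with injective
differential everywhere. -/
def IsSmoothImmersion (f : KleinBottle → UnitTangentSphere) : Prop :=
  ContDiff ℝ ∞ (fun x : ℝ × ℝ => (f (KleinBottle.mk x) : E3 × E3)) ∧
    ∀ x : ℝ × ℝ, Function.Injective
      (fderiv ℝ (fun x : ℝ × ℝ => (f (KleinBottle.mk x) : E3 × E3)) x)

/-- The `i`-th partial derivative in `ℝ³`. -/
def partialDeriv {V : Type*} [NormedAddCommGroup V] [NormedSpace ℝ V]
    (i : Fin 3) (F : (Fin 3 → ℝ) → V) (y : Fin 3 → ℝ) : V :=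
  fderiv ℝ F y (Pi.single i 1)

/-- The coefficients `g_{ij}` of the Sasaki metric in the coordinates given by `F`. -/
def metricCoeff (F : (Fin 3 → ℝ) → E3 × E3) (y : Fin 3 → ℝ) : Matrix (Fin 3) (Fin 3) ℝ :=
  Matrix.of fun i j => sasaki (F y) (partialDeriv i F y) (partialDeriv j F y)

/-- The Christoffel symbols `Γ^l_{ij}` of the Levi-Civita connection of the Sasaki metric in the
coordinates given by `F`. -/
def christoffel (F : (Fin 3 → ℝ) → E3 × E3) (y : Fin 3 → ℝ) (l i j : Fin 3) : ℝ :=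
  1 / 2 * ∑ m, (metricCoeff F y)⁻¹ l m *
    (partialDeriv i (fun z => metricCoeff F z j m) y
      + partialDeriv j (fun z => metricCoeff F z i m) y
      - partialDeriv m (fun z => metricCoeff F z i j) y)

/-- Local coordinates `F` of the unit tangent bundle, centred at a point `y` of the plane
`{y₂ = 0}`, in which the parametrized surface `u` is the coordinate plane `{y₂ = 0}`. -/
structure IsAdaptedChart (u : ℝ × ℝ → E3 × E3) (F : (Fin 3 → ℝ) → E3 × E3) (y : Fin 3 → ℝ) :
    Prop where
  mem_plane : y 2 = 0
  smooth : ContDiffAt ℝ ∞ F y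
  mapsTo : ∀ᶠ z in 𝓝 y, F z ∈ unitTangentSet
  regular : Function.Injective (fderiv ℝ F y)
  eq_surface : ∀ᶠ z in 𝓝 y, z 2 = 0 → F z = u (z 0, z 1)

/-- The mean curvature of the surface `{y₂ = 0}` at `y` in the coordinates `F`: half the trace, with
respect to the first fundamental form `h_{ab} = g_{ab}` (`a, b ∈ {0, 1}`), of the second fundamental
form `g(∇_{∂_a} ∂_b, ν) = Γ²_{ab} / √(g²²)`, where `ν = grad y₂ / |grad y₂|` is the unit normal and
`|grad y₂|² = g²²`. -/
def meanCurvature (F : (Fin 3 → ℝ) → E3 × E3) (y : Fin 3 → ℝ) : ℝ :=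
  1 / 2 * ∑ a : Fin 2, ∑ b : Fin 2,
    ((metricCoeff F y).submatrix Fin.castSucc Fin.castSucc)⁻¹ a b *
      (christoffel F y 2 a.castSucc b.castSucc / √((metricCoeff F y)⁻¹ 2 2))

/-- A minimal immersion of the Klein bottle in the unit tangent bundle with the Sasaki metric: a
smooth immersion whose mean curvature vanishes at every point. -/
def IsMinimalImmersion (f : KleinBottle → UnitTangentSphere) : Prop :=
  IsSmoothImmersion f ∧
    ∀ (F : (Fin 3 → ℝ) → E3 × E3) (y : Fin 3 → ℝ),
      IsAdaptedChart (fun x => (f (KleinBottle.mk x) : E3 × E3)) F y → meanCurvature F y = 0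

end KleinField

end

noncomputable section

namespace KleinField

/-! ### A moving frame along the sphere -/

/-! Use polar coordinates: colatitude `φ = 2πs`, longitude `β = πt`, and put `c = k - 1`. The field
is the vector making angle `cβ` with the parallel, a formula that makes sense for every real `φ`,
poles included; this gives `lift c` on the plane. It has period 1 in `s`. Since `(φ, β)` and `(-φ, β
+ π)` describe the same point of the sphere, while both frame vectors change sign, the glide
reflection preserves `lift c` exactly when the angle also gains an odd multiple of `π`; for even `k`
it does (`lift_neg_add_one`), so the map descends to the Klein bottle.

The fibre component of `∂_t` has length `π (c - cos φ)`, positive because `c > 1`; hence the map is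
an immersion, even over the poles (`injective_fderiv_lift`).

Minimality comes from the coordinate lines, which are orthogonal. An `s`-line is a parallel unit
field along a great circle, hence a Sasaki geodesic. A `t`-line is an orbit of isometries (rotation
about the axis combined with rotation of the fibres), so its acceleration is minus half the gradient
of the squared speed `π² (1 + c² - 2c cos φ)`, a multiple of `∂_s`. Neither acceleration has a
normal component, so the trace of the second fundamental form vanishes; its mixed entry is
irrelevant. The proof checks this by direct computation (`acceleration_liftDeriv₀₀`,
`acceleration_liftDeriv₁₁`) and passes to Christoffel symbols through
`christoffel_eq_zero_of_acceleration`.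

For the images, the two bands correspond to `cos φ ≥ 0` and `cos φ ≤ 0`. Each image is compact and
contains the section over its hemisphere; conversely, points over a pole are limits along `s`-lines
of points of the section. -/

theorem hasDerivAt_euclideanSpace {ι : Type*} [Fintype ι] {f : ℝ → EuclideanSpace ℝ ι}
    {f' : EuclideanSpace ℝ ι} {t : ℝ} (h : ∀ i, HasDerivAt (fun s => f s i) (f' i) t) :
    HasDerivAt f f' t := by
  rw [hasDerivAt_iff_hasFDerivAt, ← hasFDerivWithinAt_univ, hasFDerivWithinAt_euclidean]
  intro i
  rw [hasFDerivWithinAt_univ]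
  refine (h i).hasFDerivAt.congr_fderiv ?_
  ext
  simp

/-- The point of the sphere with colatitude `φ` and longitude `β`. -/
def spherePoint (φ β : ℝ) : E3 :=
  !₂[Real.sin φ * Real.cos β, Real.sin φ * Real.sin β, Real.cos φ]

/-- The unit vector tangent to the parallels at longitude `β`. -/
def parallelVec (β : ℝ) : E3 := !₂[-Real.sin β, Real.cos β, 0]

/-- The unit vector tangent to the meridian at colatitude `φ` and longitude `β`. -/
def meridianVec (φ β : ℝ) : E3 :=
  !₂[Real.cos φ * Real.cos β, Real.cos φ * Real.sin β, -Real.sin φ]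

/-- The unit tangent vector making the angle `c β` with the parallel. -/
def spinVec (c φ β : ℝ) : E3 :=
  Real.cos (c * β) • parallelVec β + Real.sin (c * β) • meridianVec φ β

/-- The unit tangent vector orthogonal to `spinVec`. -/
def spinNormal (c φ β : ℝ) : E3 :=
  -Real.sin (c * β) • parallelVec β + Real.cos (c * β) • meridianVec φ β

section inner

variable (φ β : ℝ)

theorem inner_spherePoint_self : inner ℝ (spherePoint φ β) (spherePoint φ β) = 1 := by
  rw [PiLp.inner_apply, Fin.sum_univ_three]
  simp [spherePoint, mul_pow]
  linear_combination Real.sin φ ^ 2 * Real.sin_sq_add_cos_sq β + Real.sin_sq_add_cos_sq φ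

theorem inner_parallelVec_self : inner ℝ (parallelVec β) (parallelVec β) = 1 := by
  rw [PiLp.inner_apply, Fin.sum_univ_three]
  simp [parallelVec]

theorem inner_meridianVec_self : inner ℝ (meridianVec φ β) (meridianVec φ β) = 1 := by
  rw [PiLp.inner_apply, Fin.sum_univ_three]
  simp [meridianVec, mul_pow]
  linear_combination Real.cos φ ^ 2 * Real.sin_sq_add_cos_sq β + Real.sin_sq_add_cos_sq φ

theorem inner_spherePoint_parallelVec : inner ℝ (spherePoint φ β) (parallelVec β) = 0 := by
  simp [spherePoint, parallelVec, PiLp.inner_apply, Fin.sum_univ_three]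
  ring

theorem inner_spherePoint_meridianVec : inner ℝ (spherePoint φ β) (meridianVec φ β) = 0 := by
  simp [spherePoint, meridianVec, PiLp.inner_apply, Fin.sum_univ_three]
  linear_combination Real.sin φ * Real.cos φ * Real.sin_sq_add_cos_sq β

theorem inner_parallelVec_meridianVec : inner ℝ (parallelVec β) (meridianVec φ β) = 0 := by
  simp [parallelVec, meridianVec, PiLp.inner_apply, Fin.sum_univ_three]
  ring

theorem inner_parallelVec_spherePoint : inner ℝ (parallelVec β) (spherePoint φ β) = 0 := by
  rw [real_inner_comm, inner_spherePoint_parallelVec]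

theorem inner_meridianVec_spherePoint : inner ℝ (meridianVec φ β) (spherePoint φ β) = 0 := by
  rw [real_inner_comm, inner_spherePoint_meridianVec]

theorem inner_meridianVec_parallelVec : inner ℝ (meridianVec φ β) (parallelVec β) = 0 := by
  rw [real_inner_comm, inner_parallelVec_meridianVec]

end inner

theorem spinVec_mem (c φ β : ℝ) : (spherePoint φ β, spinVec c φ β) ∈ unitTangentSet := by
  refine ⟨?_, ?_, ?_⟩
  · rw [← sq_eq_sq₀ (norm_nonneg _) zero_le_one, ← real_inner_self_eq_norm_sq,
      inner_spherePoint_self, one_pow]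
  · rw [← sq_eq_sq₀ (norm_nonneg _) zero_le_one, ← real_inner_self_eq_norm_sq]
    simp only [spinVec, inner_add_left, inner_add_right, real_inner_smul_left,
      real_inner_smul_right, inner_parallelVec_self, inner_meridianVec_self,
      inner_parallelVec_meridianVec, inner_meridianVec_parallelVec]
    linear_combination Real.sin_sq_add_cos_sq (c * β)
  · simp [spinVec, inner_add_right, real_inner_smul_right, inner_spherePoint_parallelVec,
      inner_spherePoint_meridianVec]

section deriv

variable (c φ β : ℝ)

theorem hasDerivAt_spherePoint_colatitude :
    HasDerivAt (fun s => spherePoint s β) (meridianVec φ β) φ := by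
  refine hasDerivAt_euclideanSpace fun i => ?_
  fin_cases i
  · simpa [spherePoint, meridianVec] using (Real.hasDerivAt_sin φ).mul_const (Real.cos β)
  · simpa [spherePoint, meridianVec] using (Real.hasDerivAt_sin φ).mul_const (Real.sin β)
  · simpa [spherePoint, meridianVec] using Real.hasDerivAt_cos φ

theorem hasDerivAt_spherePoint_longitude :
    HasDerivAt (fun s => spherePoint φ s) (Real.sin φ • parallelVec β) β := by
  refine hasDerivAt_euclideanSpace fun i => ?_
  fin_cases i
  · simpa [spherePoint, parallelVec] using (Real.hasDerivAt_cos β).const_mul (Real.sin φ)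
  · simpa [spherePoint, parallelVec] using (Real.hasDerivAt_sin β).const_mul (Real.sin φ)
  · simpa [spherePoint, parallelVec] using hasDerivAt_const β (Real.cos φ)

theorem hasDerivAt_meridianVec_colatitude :
    HasDerivAt (fun s => meridianVec s β) (-spherePoint φ β) φ := by
  refine hasDerivAt_euclideanSpace fun i => ?_
  fin_cases i
  · simpa [spherePoint, meridianVec] using (Real.hasDerivAt_cos φ).mul_const (Real.cos β)
  · simpa [spherePoint, meridianVec] using (Real.hasDerivAt_cos φ).mul_const (Real.sin β)
  · simpa [spherePoint, meridianVec] using (Real.hasDerivAt_sin φ).fun_neg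

theorem hasDerivAt_meridianVec_longitude :
    HasDerivAt (fun s => meridianVec φ s) (Real.cos φ • parallelVec β) β := by
  refine hasDerivAt_euclideanSpace fun i => ?_
  fin_cases i
  · simpa [meridianVec, parallelVec] using (Real.hasDerivAt_cos β).const_mul (Real.cos φ)
  · simpa [meridianVec, parallelVec] using (Real.hasDerivAt_sin β).const_mul (Real.cos φ)
  · simpa [meridianVec, parallelVec] using hasDerivAt_const β (-Real.sin φ)

/-- The derivative `-(cos β, sin β, 0)` does not involve `φ`; it is expanded in the frame at an
arbitrary colatitude so that it combines with the other derivatives. -/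
theorem hasDerivAt_parallelVec :
    HasDerivAt parallelVec
      (-(Real.sin φ • spherePoint φ β + Real.cos φ • meridianVec φ β)) β := by
  refine hasDerivAt_euclideanSpace fun i => ?_
  fin_cases i
  · simp [spherePoint, meridianVec, parallelVec]
    refine (Real.hasDerivAt_sin β).fun_neg.congr_deriv ?_
    linear_combination Real.cos β * Real.sin_sq_add_cos_sq φ
  · simp [spherePoint, meridianVec, parallelVec]
    refine (Real.hasDerivAt_cos β).congr_deriv ?_
    linear_combination Real.sin β * Real.sin_sq_add_cos_sq φ
  · simp [spherePoint, meridianVec, parallelVec]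
    refine (hasDerivAt_const β (0 : ℝ)).congr_deriv ?_
    ring

theorem hasDerivAt_cos_const_mul :
    HasDerivAt (fun s => Real.cos (c * s)) (-(c * Real.sin (c * β))) β := by
  refine ((hasDerivAt_id β).const_mul c).cos.congr_deriv ?_
  simp only [id]
  ring

theorem hasDerivAt_sin_const_mul :
    HasDerivAt (fun s => Real.sin (c * s)) (c * Real.cos (c * β)) β := by
  refine ((hasDerivAt_id β).const_mul c).sin.congr_deriv ?_
  simp only [id]
  ring

/-- The derivative is normal to the sphere: the field is parallel along meridians. -/
theorem hasDerivAt_spinVec_colatitude :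
    HasDerivAt (fun s => spinVec c s β) (-Real.sin (c * β) • spherePoint φ β) φ := by
  refine (((hasDerivAt_meridianVec_colatitude φ β).const_smul (Real.sin (c * β))).const_add
    (Real.cos (c * β) • parallelVec β)).congr_deriv ?_
  module

/-- The coefficient `c - cos φ` is the covariant rotation speed: `c` from the spinning angle, `-cos
φ` from the rotation of the frame along the parallel. -/
theorem hasDerivAt_spinVec_longitude :
    HasDerivAt (fun s => spinVec c φ s)
      ((c - Real.cos φ) • spinNormal c φ β
        - (Real.cos (c * β) * Real.sin φ) • spherePoint φ β) β := by
  refine (((hasDerivAt_cos_const_mul c β).smul (hasDerivAt_parallelVec φ β)).add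
    ((hasDerivAt_sin_const_mul c β).smul (hasDerivAt_meridianVec_longitude φ β))).congr_deriv ?_
  simp only [spinNormal]
  module

theorem hasDerivAt_spinNormal_longitude :
    HasDerivAt (fun s => spinNormal c φ s)
      ((Real.cos φ - c) • spinVec c φ β
        + (Real.sin (c * β) * Real.sin φ) • spherePoint φ β) β := by
  refine (((hasDerivAt_sin_const_mul c β).fun_neg.smul (hasDerivAt_parallelVec φ β)).add
    ((hasDerivAt_cos_const_mul c β).smul (hasDerivAt_meridianVec_longitude φ β))).congr_deriv ?_
  simp only [spinVec]
  module

end deriv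

/-! ### The lift to the plane and its derivatives -/

/-- The immersion of the plane whose projection to the Klein bottle is the minimal immersion. -/
def lift (c : ℝ) (x : ℝ × ℝ) : E3 × E3 :=
  (spherePoint (2 * Real.pi * x.1) (Real.pi * x.2),
    spinVec c (2 * Real.pi * x.1) (Real.pi * x.2))

theorem lift_mem (c : ℝ) (x : ℝ × ℝ) : lift c x ∈ unitTangentSet := spinVec_mem _ _ _

theorem contDiff_lift (c : ℝ) : ContDiff ℝ ∞ (lift c) := by
  refine ContDiff.prodMk (contDiff_euclidean.2 fun i => ?_) (contDiff_euclidean.2 fun i => ?_) <;>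
    fin_cases i <;> simp [spherePoint, spinVec, parallelVec, meridianVec] <;> fun_prop

/-- The partial derivative of `lift` in the first variable. -/
def liftDeriv₀ (c : ℝ) (x : ℝ × ℝ) : E3 × E3 :=
  (2 * Real.pi) • (meridianVec (2 * Real.pi * x.1) (Real.pi * x.2),
    -Real.sin (c * (Real.pi * x.2)) • spherePoint (2 * Real.pi * x.1) (Real.pi * x.2))

/-- The second partial derivative of `lift` in the first variable. -/
def liftDeriv₀₀ (c : ℝ) (x : ℝ × ℝ) : E3 × E3 :=
  (2 * Real.pi) ^ 2 • (-spherePoint (2 * Real.pi * x.1) (Real.pi * x.2),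
    -Real.sin (c * (Real.pi * x.2)) • meridianVec (2 * Real.pi * x.1) (Real.pi * x.2))

/-- The partial derivative of `lift` in the second variable. -/
def liftDeriv₁ (c : ℝ) (x : ℝ × ℝ) : E3 × E3 :=
  let φ := 2 * Real.pi * x.1
  let β := Real.pi * x.2
  Real.pi • (Real.sin φ • parallelVec β, (c - Real.cos φ) • spinNormal c φ β
        - (Real.cos (c * β) * Real.sin φ) • spherePoint φ β)

/-- The second partial derivative of `lift` in the second variable. -/
def liftDeriv₁₁ (c : ℝ) (x : ℝ × ℝ) : E3 × E3 :=
  let φ := 2 * Real.pi * x.1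
  let β := Real.pi * x.2
  Real.pi ^ 2 • (-Real.sin φ • (Real.sin φ • spherePoint φ β + Real.cos φ • meridianVec φ β),
    (-(c - Real.cos φ) ^ 2) • spinVec c φ β
      + ((2 * c - Real.cos φ) * Real.sin (c * β) * Real.sin φ) • spherePoint φ β
      - (Real.cos (c * β) * Real.sin φ ^ 2) • parallelVec β)

section liftDeriv

variable (c s t : ℝ)

theorem hasDerivAt_lift_fst :
    HasDerivAt (fun s => lift c (s, t)) (liftDeriv₀ c (s, t)) s := by
  have h : HasDerivAt (fun s => 2 * Real.pi * s) (2 * Real.pi) s := by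
    simpa using (hasDerivAt_id s).const_mul (2 * Real.pi)
  exact ((hasDerivAt_spherePoint_colatitude _ (Real.pi * t)).scomp s h).prodMk
    ((hasDerivAt_spinVec_colatitude c _ (Real.pi * t)).scomp s h)

theorem hasDerivAt_liftDeriv₀_fst :
    HasDerivAt (fun s => liftDeriv₀ c (s, t)) (liftDeriv₀₀ c (s, t)) s := by
  have h : HasDerivAt (fun s => 2 * Real.pi * s) (2 * Real.pi) s := by
    simpa using (hasDerivAt_id s).const_mul (2 * Real.pi)
  refine ((((hasDerivAt_meridianVec_colatitude _ (Real.pi * t)).scomp s h).prodMk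
    (((hasDerivAt_spherePoint_colatitude _ (Real.pi * t)).scomp s h).const_smul
      (-Real.sin (c * (Real.pi * t))))).const_smul (2 * Real.pi)).congr_deriv ?_
  ext1 <;> simp only [liftDeriv₀₀, Prod.smul_fst, Prod.smul_snd] <;> module

theorem hasDerivAt_lift_snd :
    HasDerivAt (fun t => lift c (s, t)) (liftDeriv₁ c (s, t)) t := by
  have h : HasDerivAt (fun t => Real.pi * t) Real.pi t := by
    simpa using (hasDerivAt_id t).const_mul Real.pi
  exact ((hasDerivAt_spherePoint_longitude (2 * Real.pi * s) _).scomp t h).prodMk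
    ((hasDerivAt_spinVec_longitude c (2 * Real.pi * s) _).scomp t h)

theorem hasDerivAt_liftDeriv₁_snd :
    HasDerivAt (fun t => liftDeriv₁ c (s, t)) (liftDeriv₁₁ c (s, t)) t := by
  have h : HasDerivAt (fun t => Real.pi * t) Real.pi t := by
    simpa using (hasDerivAt_id t).const_mul Real.pi
  set φ := 2 * Real.pi * s with hφ
  have h1 := ((hasDerivAt_parallelVec φ (Real.pi * t)).const_smul (Real.sin φ)).scomp t h
  have h2 := (((hasDerivAt_spinNormal_longitude c φ (Real.pi * t)).const_smul
    (c - Real.cos φ)).sub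
    (((hasDerivAt_cos_const_mul c (Real.pi * t)).mul_const (Real.sin φ)).smul
      (hasDerivAt_spherePoint_longitude φ (Real.pi * t)))).scomp t h
  refine ((h1.prodMk h2).const_smul Real.pi).congr_deriv ?_
  ext1 <;> simp only [liftDeriv₁₁, Prod.smul_fst, Prod.smul_snd, ← hφ] <;> module

end liftDeriv

theorem fderiv_lift (c : ℝ) (x a : ℝ × ℝ) :
    fderiv ℝ (lift c) x a = a.1 • liftDeriv₀ c x + a.2 • liftDeriv₁ c x := by
  have hd : HasFDerivAt (lift c) (fderiv ℝ (lift c) x) x :=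
    ((contDiff_lift c).differentiable (by simp) x).hasFDerivAt
  have h0 : fderiv ℝ (lift c) x (1, 0) = liftDeriv₀ c x :=
    (HasFDerivAt.comp_hasDerivAt (l := lift c) x.1 hd ((hasDerivAt_id x.1).prodMk (hasDerivAt_const x.1 x.2))).unique
      (hasDerivAt_lift_fst c x.1 x.2)
  have h1 : fderiv ℝ (lift c) x (0, 1) = liftDeriv₁ c x :=
    (HasFDerivAt.comp_hasDerivAt (l := lift c) x.2 hd ((hasDerivAt_const x.2 x.1).prodMk (hasDerivAt_id x.2))).unique
      (hasDerivAt_lift_snd c x.1 x.2)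
  rw [← h0, ← h1, ← map_smul, ← map_smul, ← map_add]
  simp

theorem injective_fderiv_lift {c : ℝ} (hc : 1 < c) (x : ℝ × ℝ) :
    Function.Injective (fderiv ℝ (lift c) x) := by
  rw [injective_iff_map_eq_zero]
  rintro ⟨a, b⟩ h
  rw [fderiv_lift] at h
  have hpi := Real.pi_ne_zero
  have hd : c - Real.cos (2 * Real.pi * x.1) ≠ 0 :=
    (sub_pos.2 ((Real.cos_le_one _).trans_lt hc)).ne'
  -- Pairing the base part with the meridian direction isolates `a`; pairing the fibre part with
  -- `spinNormal` isolates `b`, with factor `c - cos φ`.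
  have h1 := congrArg (fun w : E3 × E3 => (inner ℝ
    (meridianVec (2 * Real.pi * x.1) (Real.pi * x.2)) w.1 : ℝ)) h
  have h2 := congrArg (fun w : E3 × E3 => (inner ℝ
    (spinNormal c (2 * Real.pi * x.1) (Real.pi * x.2)) w.2 : ℝ)) h
  simp only [liftDeriv₀, liftDeriv₁, spinNormal, inner_add_left, inner_add_right, inner_sub_right,
    real_inner_smul_left, real_inner_smul_right, inner_parallelVec_self, inner_meridianVec_self,
    inner_parallelVec_meridianVec, inner_meridianVec_parallelVec, inner_parallelVec_spherePoint,
    inner_meridianVec_spherePoint, Prod.fst_add, Prod.snd_add, Prod.smul_fst, Prod.smul_snd,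
    Prod.fst_zero, Prod.snd_zero, inner_zero_right] at h1 h2
  have ha : a = 0 := by
    have : a * (2 * Real.pi) = 0 := by linear_combination h1
    simpa [hpi] using this
  have hb : b = 0 := by
    have : b * (Real.pi * (c - Real.cos (2 * Real.pi * x.1))) = 0 := by
      linear_combination h2 - b * Real.pi * (c - Real.cos (2 * Real.pi * x.1)) *
        Real.sin_sq_add_cos_sq (c * (Real.pi * x.2))
    simpa [hpi, hd] using this
  simp [ha, hb]

/-! ### The geodesic curvature form of the Sasaki metric -/

/-- The value on the tangent vector `v` of the covariant acceleration at `q`, for the Sasaki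
metric, of a curve with velocity `w` and ambient second derivative `w'`. -/
def acceleration (q w w' v : E3 × E3) : ℝ :=
  inner ℝ w'.1 v.1 + inner ℝ w'.2 v.2
    - (inner ℝ w.1 w.2 + inner ℝ q.1 w'.2) * inner ℝ q.1 v.2
    - inner ℝ q.1 w.2 * (inner ℝ w.1 v.2 - inner ℝ v.1 w.2)

/-- Expanding the two projections with `|p| = 1` leaves a form that is easy to differentiate. -/
theorem sasaki_eq {q : E3 × E3} (hq : ‖q.1‖ = 1) (w w' : E3 × E3) :
    sasaki q w w' =
      inner ℝ w.1 w'.1 + inner ℝ w.2 w'.2 - inner ℝ q.1 w.2 * inner ℝ q.1 w'.2 := by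
  have h : inner ℝ q.1 q.1 = (1 : ℝ) := by rw [real_inner_self_eq_norm_sq, hq, one_pow]
  simp only [sasaki, inner_sub_left, inner_sub_right, real_inner_smul_left, real_inner_smul_right,
    h, real_inner_comm q.1 w.2]
  ring

theorem sasaki_comm (q w w' : E3 × E3) : sasaki q w w' = sasaki q w' w := by
  simp only [sasaki, real_inner_comm]

theorem metricCoeff_comm (F : (Fin 3 → ℝ) → E3 × E3) (y : Fin 3 → ℝ) (i j : Fin 3) :
    metricCoeff F y i j = metricCoeff F y j i := sasaki_comm _ _ _

section

variable {X : Type*} [NormedAddCommGroup X] [NormedSpace ℝ X]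

theorem fderiv_sasaki {F G H : X → E3 × E3} {y : X} (hF : DifferentiableAt ℝ F y)
    (hG : DifferentiableAt ℝ G y) (hH : DifferentiableAt ℝ H y)
    (hn : ∀ᶠ z in 𝓝 y, ‖(F z).1‖ = 1) (e : X) :
    fderiv ℝ (fun z => sasaki (F z) (G z) (H z)) y e =
      inner ℝ (fderiv ℝ G y e).1 (H y).1 + inner ℝ (G y).1 (fderiv ℝ H y e).1
      + (inner ℝ (fderiv ℝ G y e).2 (H y).2 + inner ℝ (G y).2 (fderiv ℝ H y e).2)
      - (inner ℝ (fderiv ℝ F y e).1 (G y).2 + inner ℝ (F y).1 (fderiv ℝ G y e).2)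
        * inner ℝ (F y).1 (H y).2
      - inner ℝ (F y).1 (G y).2
        * (inner ℝ (fderiv ℝ F y e).1 (H y).2 + inner ℝ (F y).1 (fderiv ℝ H y e).2) := by
  have heq : (fun z => sasaki (F z) (G z) (H z)) =ᶠ[𝓝 y] fun z =>
      inner ℝ (G z).1 (H z).1 + inner ℝ (G z).2 (H z).2
        - inner ℝ (F z).1 (G z).2 * inner ℝ (F z).1 (H z).2 := by
    filter_upwards [hn] with z hz using sasaki_eq hz _ _
  have hd := (((hG.hasFDerivAt.fst).inner ℝ hH.hasFDerivAt.fst).add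
    ((hG.hasFDerivAt.snd).inner ℝ hH.hasFDerivAt.snd)).sub
    (((hF.hasFDerivAt.fst).inner ℝ hG.hasFDerivAt.snd).mul
      ((hF.hasFDerivAt.fst).inner ℝ hH.hasFDerivAt.snd))
  rw [(HasFDerivAt.congr_of_eventuallyEq hd heq).fderiv]
  simp [fderivInnerCLM_apply]
  ring

/-- The vector `v` is tangent to the unit tangent bundle at `q`. -/
def IsTangent (q v : E3 × E3) : Prop :=
  inner ℝ q.1 v.1 = (0 : ℝ) ∧ inner ℝ q.2 v.2 = (0 : ℝ) ∧
    inner ℝ v.1 q.2 + inner ℝ q.1 v.2 = (0 : ℝ)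

/-- Each of the three defining equations says that an inner product is locally constant;
differentiate it. -/
theorem isTangent_fderiv {F : X → E3 × E3} {y : X} (hF : DifferentiableAt ℝ F y)
    (hm : ∀ᶠ z in 𝓝 y, F z ∈ unitTangentSet) (e : X) :
    IsTangent (F y) (fderiv ℝ F y e) := by
  have hP := hF.hasFDerivAt.fst
  have hV := hF.hasFDerivAt.snd
  have key : ∀ {f g : X → E3} {f' g' : X →L[ℝ] E3} {r : ℝ}, HasFDerivAt f f' y →
      HasFDerivAt g g' y → (∀ᶠ z in 𝓝 y, inner ℝ (f z) (g z) = r) →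
      inner ℝ (f y) (g' e) + inner ℝ (f' e) (g y) = (0 : ℝ) := by
    intro f g f' g' r hf hg h
    have h1 := (hf.inner ℝ hg).fderiv
    have h2 : (fun z => (inner ℝ (f z) (g z) : ℝ)) =ᶠ[𝓝 y] fun _ => r := h
    rw [h2.fderiv_eq, fderiv_fun_const] at h1
    simpa [fderivInnerCLM_apply] using (congrArg (fun L : X →L[ℝ] ℝ => L e) h1).symm
  have h1 := key (r := 1) hP hP (by
    filter_upwards [hm] with z hz
    rw [real_inner_self_eq_norm_sq, hz.1, one_pow])
  have h2 := key (r := 1) hV hV (by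
    filter_upwards [hm] with z hz
    rw [real_inner_self_eq_norm_sq, hz.2.1, one_pow])
  have h3 := key (r := 0) hP hV (by filter_upwards [hm] with z hz using hz.2.2)
  refine ⟨?_, ?_, ?_⟩
  · rw [real_inner_comm (F y).1] at h1
    change inner ℝ (F y).1 (fderiv ℝ F y e).1 + inner ℝ (F y).1 (fderiv ℝ F y e).1 = (0 : ℝ) at h1
    linarith
  · rw [real_inner_comm (F y).2] at h2
    change inner ℝ (F y).2 (fderiv ℝ F y e).2 + inner ℝ (F y).2 (fderiv ℝ F y e).2 = (0 : ℝ) at h2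
    linarith
  · change inner ℝ (F y).1 (fderiv ℝ F y e).2 + inner ℝ (fderiv ℝ F y e).1 (F y).2 = (0 : ℝ) at h3
    linarith

end

/-! ### Christoffel symbols and mean curvature in a chart -/

section chart

variable {F : (Fin 3 → ℝ) → E3 × E3} {y : Fin 3 → ℝ}

theorem differentiableAt_partialDeriv (hF : ContDiffAt ℝ ∞ F y) (i : Fin 3) :
    DifferentiableAt ℝ (partialDeriv i F) y :=
  ((hF.fderiv_right (m := 1) (WithTop.coe_le_coe.2 le_top)).differentiableAt one_ne_zero).clm_apply
    (differentiableAt_const _)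

theorem partialDeriv_partialDeriv_comm (hF : ContDiffAt ℝ ∞ F y) (i j : Fin 3) :
    partialDeriv i (partialDeriv j F) y = partialDeriv j (partialDeriv i F) y := by
  have hd : DifferentiableAt ℝ (fderiv ℝ F) y :=
    (hF.fderiv_right (m := 1) (WithTop.coe_le_coe.2 le_top)).differentiableAt one_ne_zero
  have key : ∀ i j, partialDeriv i (partialDeriv j F) y =
      fderiv ℝ (fderiv ℝ F) y (Pi.single i 1) (Pi.single j 1) := by
    intro i j
    have h : partialDeriv j F = fun z => fderiv ℝ F z (Pi.single j 1) := rfl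
    rw [partialDeriv, h, fderiv_clm_apply hd (differentiableAt_const _)]
    simp
  rw [key, key]
  exact (hF.isSymmSndFDerivAt (by simpa using ENat.LEInfty.out)).eq _ _

/-- Twice the Christoffel symbol of the first kind `Γ_{m,aa}` of the Sasaki metric. -/
theorem two_mul_christoffel_first_kind (hF : ContDiffAt ℝ ∞ F y)
    (hm : ∀ᶠ z in 𝓝 y, F z ∈ unitTangentSet) (a m : Fin 3) :
    partialDeriv a (fun z => metricCoeff F z a m) y
      + partialDeriv a (fun z => metricCoeff F z a m) y
      - partialDeriv m (fun z => metricCoeff F z a a) y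
      = 2 * acceleration (F y) (partialDeriv a F y) (partialDeriv a (partialDeriv a F) y)
        (partialDeriv m F y) := by
  have hd := hF.differentiableAt (by simp)
  have hn : ∀ᶠ z in 𝓝 y, ‖(F z).1‖ = 1 := by filter_upwards [hm] with z hz using hz.1
  have key : ∀ l i j, partialDeriv l (fun z => metricCoeff F z i j) y = _ := fun l i j =>
    fderiv_sasaki hd (differentiableAt_partialDeriv hF i) (differentiableAt_partialDeriv hF j) hn
      (Pi.single l 1)
  -- Symmetry of the mixed derivative cancels all second-order terms except those in `∂_a ∂_a F`.
  have hs : fderiv ℝ (partialDeriv m F) y (Pi.single a 1) =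
    fderiv ℝ (partialDeriv a F) y (Pi.single m 1) := partialDeriv_partialDeriv_comm hF a m
  rw [key, key, hs]
  change _ = 2 * acceleration (F y) (fderiv ℝ F y (Pi.single a 1))
    (fderiv ℝ (partialDeriv a F) y (Pi.single a 1)) (fderiv ℝ F y (Pi.single m 1))
  simp only [acceleration, show ∀ i, partialDeriv i F y = fderiv ℝ F y (Pi.single i 1) from
    fun _ => rfl]
  rw [real_inner_comm (fderiv ℝ F y (Pi.single a 1)).1
    (fderiv ℝ (partialDeriv a F) y (Pi.single m 1)).1,
    real_inner_comm (fderiv ℝ F y (Pi.single a 1)).2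
    (fderiv ℝ (partialDeriv a F) y (Pi.single m 1)).2]
  ring

/-- If the acceleration of a coordinate line is a combination of the coordinate fields other than
`∂_l`, it has no component along the normal of the level set of the `l`-th coordinate. -/
theorem christoffel_eq_zero_of_acceleration (hF : ContDiffAt ℝ ∞ F y)
    (hm : ∀ᶠ z in 𝓝 y, F z ∈ unitTangentSet) {a b l : Fin 3} (hbl : b ≠ l) {r : ℝ}
    (h : ∀ v, IsTangent (F y) v →
      acceleration (F y) (partialDeriv a F y) (partialDeriv a (partialDeriv a F) y) v
        = r * sasaki (F y) (partialDeriv b F y) v) :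
    christoffel F y l a a = 0 := by
  have hd := hF.differentiableAt (by simp)
  -- Raising the index turns `r g_{bm}` into `r δ^l_b`, which vanishes because `b ≠ l`.
  have h1 : christoffel F y l a a = r * ((metricCoeff F y)⁻¹ * metricCoeff F y) l b := by
    rw [christoffel, Matrix.mul_apply, Finset.mul_sum, Finset.mul_sum]
    refine Finset.sum_congr rfl fun m _ => ?_
    have hv := h (partialDeriv m F y) (isTangent_fderiv hd hm _)
    rw [two_mul_christoffel_first_kind hF hm, hv, metricCoeff_comm F y m b]
    change _ = r * (_ * sasaki (F y) (partialDeriv b F y) (partialDeriv m F y))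
    ring
  rw [h1]
  -- Nondegeneracy of the metric need not be proved: a singular matrix has inverse `0` by
  -- convention, and the product vanishes anyway.
  by_cases hu : IsUnit (metricCoeff F y).det
  · rw [Matrix.nonsing_inv_mul _ hu, Matrix.one_apply_ne hbl.symm, mul_zero]
  · rw [Matrix.nonsing_inv_apply_not_isUnit _ hu]
    simp

/-- The mean curvature vanishes when the coordinate lines are orthogonal and asymptotic. -/
theorem meanCurvature_eq_zero (h01 : metricCoeff F y 0 1 = 0) (h0 : christoffel F y 2 0 0 = 0)
    (h1 : christoffel F y 2 1 1 = 0) : meanCurvature F y = 0 := by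
  have h10 : metricCoeff F y 1 0 = 0 := by rw [metricCoeff_comm, h01]
  simp only [meanCurvature, Fin.sum_univ_two, Matrix.inv_def, Matrix.adjugate_fin_two,
    Matrix.smul_apply, Matrix.of_apply, Matrix.submatrix_apply]
  -- The first fundamental form is diagonal, hence so is its inverse, and the mixed Christoffel
  -- symbols drop out.
  simp [h0, h1, h01, h10]

theorem partialDeriv_eq_of_hasDerivAt {V : Type*} [NormedAddCommGroup V] [NormedSpace ℝ V]
    {G : (Fin 3 → ℝ) → V} (hG : DifferentiableAt ℝ G y) {i : Fin 3} {γ : ℝ → V} {γ' : V}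
    (hγ : HasDerivAt γ γ' (y i)) (h : ∀ᶠ s in 𝓝 (y i), G (Function.update y i s) = γ s) :
    partialDeriv i G y = γ' := by
  have h1 : HasDerivAt (fun s => Function.update y i s) (Pi.single i (1 : ℝ)) (y i) :=
    hasDerivAt_update y i (y i)
  have h2 : HasFDerivAt G (fderiv ℝ G y) (Function.update y i (y i)) := by
    rw [Function.update_eq_self]
    exact hG.hasFDerivAt
  have h3 : HasDerivAt (fun s => G (Function.update y i s)) (fderiv ℝ G y (Pi.single i 1)) (y i) :=
    h2.comp_hasDerivAt (y i) h1
  exact h3.unique (hγ.congr_of_eventuallyEq h)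

end chart

/-! ### Minimality of the immersion -/

section acceleration

variable (c : ℝ) (x : ℝ × ℝ)

/-- `∂_s` is horizontal: its fibre part is a multiple of the base point, so only the base components
contribute. -/
theorem sasaki_liftDeriv₀ (v : E3 × E3) : sasaki (lift c x) (liftDeriv₀ c x) v =
    2 * Real.pi * inner ℝ (meridianVec (2 * Real.pi * x.1) (Real.pi * x.2)) v.1 := by
  rw [sasaki_eq (lift_mem c x).1]
  simp only [lift, liftDeriv₀, Prod.smul_fst, Prod.smul_snd, real_inner_smul_left,
    real_inner_smul_right, inner_spherePoint_self]
  ring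

theorem sasaki_liftDeriv₀_liftDeriv₁ :
    sasaki (lift c x) (liftDeriv₀ c x) (liftDeriv₁ c x) = 0 := by
  rw [sasaki_liftDeriv₀]
  simp only [liftDeriv₁, Prod.smul_fst, real_inner_smul_right, inner_meridianVec_parallelVec]
  ring

/-- The `s`-lines are horizontal lifts of great circles, hence geodesics. -/
theorem acceleration_liftDeriv₀₀ {v : E3 × E3} (hv : IsTangent (lift c x) v) :
    acceleration (lift c x) (liftDeriv₀ c x) (liftDeriv₀₀ c x) v = 0 := by
  have h1 := hv.1
  simp only [lift] at h1
  simp only [acceleration, lift, liftDeriv₀, liftDeriv₀₀, Prod.smul_fst, Prod.smul_snd,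
    inner_neg_left, real_inner_smul_left, real_inner_smul_right, inner_spherePoint_self,
    inner_spherePoint_meridianVec, inner_meridianVec_spherePoint,
    real_inner_comm (spherePoint (2 * Real.pi * x.1) (Real.pi * x.2)) v.1, h1]
  ring

/-- For a Killing field the acceleration is `-½ grad |∂_t|²`. Here this is `-π² c sin φ ∂_φ`, and
`∂_s = 2π ∂_φ` gives the factor `-(c sin φ π / 2)`. -/
theorem acceleration_liftDeriv₁₁ {v : E3 × E3} (hv : IsTangent (lift c x) v) :
    acceleration (lift c x) (liftDeriv₁ c x) (liftDeriv₁₁ c x) v =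
      -(c * Real.sin (2 * Real.pi * x.1) * Real.pi / 2) *
        sasaki (lift c x) (liftDeriv₀ c x) v := by
  rw [sasaki_liftDeriv₀]
  obtain ⟨h1, h2, h3⟩ := hv
  simp only [lift] at h1 h2 h3
  simp only [acceleration, lift, liftDeriv₁, liftDeriv₁₁, Prod.smul_fst, Prod.smul_snd]
  generalize 2 * Real.pi * x.1 = φ at *
  generalize Real.pi * x.2 = β at *
  have h3' : inner ℝ (spinVec c φ β) v.1 + inner ℝ (spherePoint φ β) v.2 = (0 : ℝ) := by
    rw [real_inner_comm] at h3
    exact h3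
  simp only [spinVec, spinNormal, inner_add_left,
    inner_add_right, inner_sub_left, inner_sub_right, real_inner_smul_left,
    real_inner_smul_right, inner_spherePoint_self,
    inner_parallelVec_self, inner_spherePoint_meridianVec, inner_parallelVec_spherePoint,
    inner_spherePoint_parallelVec, inner_parallelVec_meridianVec, real_inner_comm _ v.1,
    h1] at h2 h3' ⊢
  have hcs := Real.sin_sq_add_cos_sq (c * β)
  generalize Real.sin (c * β) = S at *
  generalize Real.cos (c * β) = C at *
  generalize Real.sin φ = σ at *
  generalize Real.cos φ = χ at *
  generalize inner ℝ (parallelVec β) v.1 = a₁ at *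
  generalize inner ℝ (parallelVec β) v.2 = b₁ at *
  generalize inner ℝ (meridianVec φ β) v.1 = a₂ at *
  generalize inner ℝ (meridianVec φ β) v.2 = b₂ at *
  generalize inner ℝ (spherePoint φ β) v.2 = b₀ at *
  -- `h2` removes the centripetal fibre term along `spinVec`; `h3'` trades `⟨p, v.2⟩` for base
  -- components of `v`.
  linear_combination Real.pi ^ 2 * (-(c - χ) ^ 2 * h2 + S * σ * (c - χ) * h3'
    - σ * (c - χ) * a₂ * hcs)

end acceleration

section chart

variable {c : ℝ} {F : (Fin 3 → ℝ) → E3 × E3} {y : Fin 3 → ℝ}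

/-- The identities are needed on a whole neighbourhood within the plane `z 2 = 0`, since they are
differentiated once more along lines in that plane. -/
theorem IsAdaptedChart.eventually_partialDeriv (h : IsAdaptedChart (lift c) F y) :
    ∀ᶠ z in 𝓝 y, z 2 = 0 → F z = lift c (z 0, z 1) ∧
      partialDeriv 0 F z = liftDeriv₀ c (z 0, z 1) ∧
      partialDeriv 1 F z = liftDeriv₁ c (z 0, z 1) := by
  have hd : ∀ᶠ z in 𝓝 y, ContDiffAt ℝ 1 F z :=
    (h.smooth.of_le (m := 1) (WithTop.coe_le_coe.2 le_top)).eventually (by simp)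
  filter_upwards [h.eq_surface, h.eq_surface.eventually_nhds, hd] with z hz hz' hdz h2
  have hdz := hdz.differentiableAt one_ne_zero
  have hu : ∀ i, Filter.Tendsto (fun s => Function.update z i s) (𝓝 (z i)) (𝓝 z) := by
    intro i
    have : Continuous fun s => Function.update z i s := continuous_const.update i continuous_id
    simpa using this.tendsto (z i)
  refine ⟨hz h2, partialDeriv_eq_of_hasDerivAt hdz (hasDerivAt_lift_fst c _ (z 1)) ?_,
    partialDeriv_eq_of_hasDerivAt hdz (hasDerivAt_lift_snd c (z 0) _) ?_⟩
  · filter_upwards [(hu 0).eventually hz'] with s hs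
    simpa using hs (by simpa using h2)
  · filter_upwards [(hu 1).eventually hz'] with s hs
    simpa using hs (by simpa using h2)

theorem IsAdaptedChart.meanCurvature_lift_eq_zero (h : IsAdaptedChart (lift c) F y) :
    meanCurvature F y = 0 := by
  have h2 := h.mem_plane
  have hev := h.eventually_partialDeriv
  obtain ⟨e, e0, e1⟩ := hev.self_of_nhds h2
  have hu : ∀ i, Filter.Tendsto (fun s => Function.update y i s) (𝓝 (y i)) (𝓝 y) := by
    intro i
    have : Continuous fun s => Function.update y i s := continuous_const.update i continuous_id
    simpa using this.tendsto (y i)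
  have e00 : partialDeriv 0 (partialDeriv 0 F) y = liftDeriv₀₀ c (y 0, y 1) := by
    refine partialDeriv_eq_of_hasDerivAt (differentiableAt_partialDeriv h.smooth 0)
      (hasDerivAt_liftDeriv₀_fst c _ (y 1)) ?_
    filter_upwards [(hu 0).eventually hev] with s hs
    simpa using (hs (by simpa using h2)).2.1
  have e11 : partialDeriv 1 (partialDeriv 1 F) y = liftDeriv₁₁ c (y 0, y 1) := by
    refine partialDeriv_eq_of_hasDerivAt (differentiableAt_partialDeriv h.smooth 1)
      (hasDerivAt_liftDeriv₁_snd c (y 0) _) ?_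
    filter_upwards [(hu 1).eventually hev] with s hs
    simpa using (hs (by simpa using h2)).2.2
  refine meanCurvature_eq_zero ?_ ?_ ?_
  · change sasaki (F y) (partialDeriv 0 F y) (partialDeriv 1 F y) = 0
    rw [e, e0, e1, sasaki_liftDeriv₀_liftDeriv₁]
  · refine christoffel_eq_zero_of_acceleration h.smooth h.mapsTo (b := 0) (r := 0) (by decide)
      fun v hv => ?_
    rw [e] at hv
    rw [e, e0, e00, acceleration_liftDeriv₀₀ c _ hv, zero_mul]
  · refine christoffel_eq_zero_of_acceleration h.smooth h.mapsTo (b := 0)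
      (r := -(c * Real.sin (2 * Real.pi * y 0) * Real.pi / 2)) (by decide)
      fun v hv => ?_
    rw [e] at hv
    rw [e, e0, e1, e11, acceleration_liftDeriv₁₁ c _ hv]

end chart

/-! ### The map of the Klein bottle and its image -/

section invariance

variable (k : ℕ)

/-- Integrality of `k - 1` makes the field independent of the branch of the longitude. -/
theorem cos_sub_one_mul_add_int_mul_two_pi (β : ℝ) (n : ℤ) :
    Real.cos (((k : ℝ) - 1) * (β + n * (2 * Real.pi))) = Real.cos (((k : ℝ) - 1) * β) := by
  rw [show ((k : ℝ) - 1) * (β + n * (2 * Real.pi)) =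
    ((k : ℝ) - 1) * β + ((((k : ℤ) - 1) * n : ℤ) : ℝ) * (2 * Real.pi) by push_cast; ring]
  exact Real.cos_add_int_mul_two_pi _ _

theorem sin_sub_one_mul_add_int_mul_two_pi (β : ℝ) (n : ℤ) :
    Real.sin (((k : ℝ) - 1) * (β + n * (2 * Real.pi))) = Real.sin (((k : ℝ) - 1) * β) := by
  rw [show ((k : ℝ) - 1) * (β + n * (2 * Real.pi)) =
    ((k : ℝ) - 1) * β + ((((k : ℤ) - 1) * n : ℤ) : ℝ) * (2 * Real.pi) by push_cast; ring]
  exact Real.sin_add_int_mul_two_pi _ _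

theorem lift_add_int_fst (c s t : ℝ) (n : ℤ) : lift c (s + n, t) = lift c (s, t) := by
  have h : 2 * Real.pi * (s + n) = 2 * Real.pi * s + n * (2 * Real.pi) := by ring
  simp only [lift, h, spherePoint, spinVec, meridianVec, Real.sin_add_int_mul_two_pi,
    Real.cos_add_int_mul_two_pi]

theorem lift_add_two_mul_int_snd (s t : ℝ) (n : ℤ) :
    lift ((k : ℝ) - 1) (s, t + 2 * n) = lift ((k : ℝ) - 1) (s, t) := by
  have h : Real.pi * (t + 2 * n) = Real.pi * t + n * (2 * Real.pi) := by ring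
  simp only [lift, h, spherePoint, spinVec, meridianVec, parallelVec, Real.sin_add_int_mul_two_pi,
    Real.cos_add_int_mul_two_pi, cos_sub_one_mul_add_int_mul_two_pi,
    sin_sub_one_mul_add_int_mul_two_pi]

variable {k}

theorem lift_neg_add_one (hk : Even k) (s t : ℝ) :
    lift ((k : ℝ) - 1) (-s, t + 1) = lift ((k : ℝ) - 1) (s, t) := by
  obtain ⟨j, rfl⟩ := hk
  have h1 : 2 * Real.pi * -s = -(2 * Real.pi * s) := by ring
  have h2 : Real.pi * (t + 1) = Real.pi * t + Real.pi := by ring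
  -- With `k = 2j` the angle gains `(2j - 1)π`, that is `-π` modulo `2π`; this sign cancels those of
  -- the two frame vectors.
  have h3 : (((j + j : ℕ) : ℝ) - 1) * (Real.pi * t + Real.pi) =
      (((j + j : ℕ) : ℝ) - 1) * (Real.pi * t) - Real.pi + (j : ℤ) * (2 * Real.pi) := by
    push_cast; ring
  simp only [lift, spinVec, h1, h2, h3, Real.sin_add_int_mul_two_pi, Real.cos_add_int_mul_two_pi,
    Real.sin_sub_pi, Real.cos_sub_pi]
  refine Prod.ext ?_ ?_
  · simp [spherePoint]
  · ext i
    fin_cases i <;> simp [parallelVec, meridianVec]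

theorem lift_eq_of_kleinSetoid (hk : Even k) {a b : ℝ × ℝ} (h : kleinSetoid.r a b) :
    lift ((k : ℝ) - 1) a = lift ((k : ℝ) - 1) b := by
  obtain ⟨s, t⟩ := a
  obtain ⟨s', t'⟩ := b
  obtain ⟨m, n, h1, h2⟩ := h
  dsimp only at h1 h2
  rw [h1, h2, lift_add_int_fst]
  rcases Int.even_or_odd' n with ⟨l, rfl | rfl⟩
  · rw [(even_two_mul l).neg_one_zpow, one_mul]
    push_cast
    rw [lift_add_two_mul_int_snd]
  · rw [(odd_two_mul_add_one l).neg_one_zpow, neg_one_mul]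
    push_cast
    rw [show t + (2 * (l : ℝ) + 1) = t + 1 + 2 * l by ring, lift_add_two_mul_int_snd,
      lift_neg_add_one hk]

end invariance

/-- The lift as a map into the unit tangent bundle. -/
def unitLift (c : ℝ) (x : ℝ × ℝ) : UnitTangentSphere := ⟨lift c x, lift_mem c x⟩

theorem continuous_unitLift (c : ℝ) : Continuous (unitLift c) :=
  (contDiff_lift c).continuous.subtype_mk _

/-- The minimal immersion of the Klein bottle. -/
def kleinMap {k : ℕ} (hk : Even k) : KleinBottle → UnitTangentSphere :=
  Quotient.lift (unitLift ((k : ℝ) - 1)) fun _ _ h => Subtype.ext (lift_eq_of_kleinSetoid hk h)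

theorem isMinimalImmersion_kleinMap {k : ℕ} (hk : Even k) (hk2 : 2 < k) :
    IsMinimalImmersion (kleinMap hk) := by
  have hc : (1 : ℝ) < (k : ℝ) - 1 := by
    have : (2 : ℝ) < k := by exact_mod_cast hk2
    linarith
  exact ⟨⟨contDiff_lift _, injective_fderiv_lift hc⟩,
    fun F y h => IsAdaptedChart.meanCurvature_lift_eq_zero h⟩

/-! ### Comparison of the lift with the field, and closures -/

/-- Positivity of `sin φ` makes it the distance to the axis and makes `β` the longitude modulo `2π`.
-/
theorem field_spherePoint (k : ℕ) {φ : ℝ} (hφ : 0 < Real.sin φ) (β : ℝ) :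
    field k (spherePoint φ β) = spinVec ((k : ℝ) - 1) φ β := by
  have hρ : √(spherePoint φ β 0 ^ 2 + spherePoint φ β 1 ^ 2) = Real.sin φ := by
    rw [← Real.sqrt_sq hφ.le]
    congr 1
    simp only [spherePoint, PiLp.toLp_apply, Matrix.cons_val_zero, Matrix.cons_val_one]
    linear_combination Real.sin φ ^ 2 * Real.sin_sq_add_cos_sq β
  have h1 : e₁ (spherePoint φ β) = parallelVec β := by
    rw [e₁, hρ]
    ext i
    fin_cases i <;> simp [spherePoint, parallelVec, hφ.ne']
  have h2 : e₂ (spherePoint φ β) = meridianVec φ β := by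
    rw [e₂, hρ]
    ext i
    fin_cases i <;> simp [spherePoint, meridianVec] <;> field_simp
  obtain ⟨n, hn⟩ : ∃ n : ℤ, longitude (spherePoint φ β) = β + n * (2 * Real.pi) := by
    -- The argument lies in `(-π, π]`; `toIocDiv` counts the periods subtracted to bring `β` there.
    refine ⟨-toIocDiv Real.two_pi_pos (-Real.pi) β, ?_⟩
    have h := Complex.arg_mul_cos_add_sin_mul_I_eq_toIocMod hφ β
    rw [toIocMod, zsmul_eq_mul] at h
    push_cast
    rw [neg_mul, ← sub_eq_add_neg, ← h, longitude]
    congr 1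
    apply Complex.ext <;> simp [spherePoint, Complex.cos_ofReal_re, Complex.sin_ofReal_re]
  rw [field, h1, h2, hn, cos_sub_one_mul_add_int_mul_two_pi, sin_sub_one_mul_add_int_mul_two_pi,
    spinVec]

theorem spherePoint_mem {φ : ℝ} (hφ : Real.sin φ ≠ 0) (β : ℝ) :
    spherePoint φ β ∈ Metric.sphere (0 : E3) 1 \ {northPole, southPole} := by
  refine ⟨by simpa using (spinVec_mem 0 φ β).1, ?_⟩
  have hs : spherePoint φ β 0 ^ 2 + spherePoint φ β 1 ^ 2 = Real.sin φ ^ 2 := by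
    simp only [spherePoint, PiLp.toLp_apply, Matrix.cons_val_zero, Matrix.cons_val_one]
    linear_combination Real.sin φ ^ 2 * Real.sin_sq_add_cos_sq β
  rintro (h | h) <;> rw [h] at hs <;> simp [northPole, southPole] at hs <;> exact hφ (pow_eq_zero_iff two_ne_zero |>.1 hs.symm)

theorem exists_section_eq_unitLift {k : ℕ} (hk : Even k) (x : ℝ × ℝ)
    (hx : Real.sin (2 * Real.pi * x.1) ≠ 0) :
    ∃ p : PuncturedSphere, section_ k p = unitLift ((k : ℝ) - 1) x ∧
      (p : E3) 2 = Real.cos (2 * Real.pi * x.1) := by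
  have key : ∀ x : ℝ × ℝ, 0 < Real.sin (2 * Real.pi * x.1) →
      ∃ p : PuncturedSphere, section_ k p = unitLift ((k : ℝ) - 1) x ∧
        (p : E3) 2 = Real.cos (2 * Real.pi * x.1) := fun x hx =>
    ⟨⟨_, spherePoint_mem hx.ne' (Real.pi * x.2)⟩,
      Subtype.ext (Prod.ext rfl (field_spherePoint k hx _)), rfl⟩
  rcases hx.lt_or_gt with h | h
  · have hneg : 2 * Real.pi * -x.1 = -(2 * Real.pi * x.1) := by ring
    -- For negative `sin φ` the glide reflection moves to positive `sin φ` without changing the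
    -- value of the lift or `cos φ`.
    obtain ⟨p, hp, hp2⟩ := key (-x.1, x.2 + 1) (by simp only [hneg, Real.sin_neg]; linarith)
    refine ⟨p, hp.trans (Subtype.ext (lift_neg_add_one hk x.1 x.2)), ?_⟩
    simpa only [hneg, Real.cos_neg] using hp2
  · exact key x h

theorem exists_unitLift_eq_section (k : ℕ) (p : PuncturedSphere) :
    ∃ x : ℝ × ℝ, unitLift ((k : ℝ) - 1) x = section_ k p ∧ 0 ≤ x.1 ∧ x.1 ≤ 1 / 2 ∧
      Real.cos (2 * Real.pi * x.1) = (p : E3) 2 := by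
  have hpi := Real.pi_pos
  obtain ⟨p, hp, hne⟩ := p
  have hs : p 0 ^ 2 + p 1 ^ 2 + p 2 ^ 2 = 1 := by
    have := EuclideanSpace.real_norm_sq_eq p
    rw [show ‖p‖ = 1 by simpa using hp, Fin.sum_univ_three] at this
    linarith
  have hz : -1 ≤ p 2 ∧ p 2 ≤ 1 := by constructor <;> nlinarith [sq_nonneg (p 0), sq_nonneg (p 1)]
  have hcos : Real.cos (Real.arccos (p 2)) = p 2 := Real.cos_arccos hz.1 hz.2
  have hnorm : ‖(⟨p 0, p 1⟩ : ℂ)‖ = Real.sin (Real.arccos (p 2)) := by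
    rw [Real.sin_arccos, Complex.norm_eq_sqrt_sq_add_sq]
    congr 1
    linarith
  have hpt : spherePoint (Real.arccos (p 2)) (longitude p) = p := by
    have hre := Complex.norm_mul_cos_arg ⟨p 0, p 1⟩
    have him := Complex.norm_mul_sin_arg ⟨p 0, p 1⟩
    rw [hnorm] at hre him
    ext i
    fin_cases i
    · exact hre
    · exact him
    · exact hcos
  have hsin : 0 < Real.sin (Real.arccos (p 2)) := by
    refine (Real.sin_nonneg_of_nonneg_of_le_pi (Real.arccos_nonneg _)
      (Real.arccos_le_pi _)).lt_of_ne fun h => hne ?_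
    have h01 : p 0 = 0 ∧ p 1 = 0 := by
      have h0 := congrArg (fun q : E3 => q 0) hpt
      have h1 := congrArg (fun q : E3 => q 1) hpt
      simp [spherePoint, ← h] at h0 h1
      exact ⟨h0.symm, h1.symm⟩
    have h2 : (p 2 - 1) * (p 2 + 1) = 0 := by rw [h01.1, h01.2] at hs; linarith
    rcases mul_eq_zero.1 h2 with h2 | h2
    · left
      ext i
      fin_cases i
      · simpa [northPole] using h01.1
      · simpa [northPole] using h01.2
      · simp [northPole]; linarith
    · right
      ext i
      fin_cases i
      · simpa [southPole] using h01.1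
      · simpa [southPole] using h01.2
      · simp [southPole]; linarith
  have hφ : 2 * Real.pi * (Real.arccos (p 2) / (2 * Real.pi)) = Real.arccos (p 2) := by
    field_simp
  have hβ : Real.pi * (longitude p / Real.pi) = longitude p := by field_simp
  refine ⟨(Real.arccos (p 2) / (2 * Real.pi), longitude p / Real.pi), ?_,
    div_nonneg (Real.arccos_nonneg _) (by positivity), ?_, ?_⟩
  · refine Subtype.ext ?_
    change (spherePoint _ _, spinVec _ _ _) = (p, field k p)
    simp only [hφ, hβ]
    rw [← field_spherePoint k hsin, hpt]
  · rw [div_le_iff₀ (by positivity)]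
    linarith [Real.arccos_le_pi (p 2)]
  · simp only [hφ, hcos]

/-- Period 2 in `t` reduces the strip to a compact rectangle. -/
theorem isClosed_unitLift_image (k : ℕ) (a b : ℝ) :
    IsClosed (unitLift ((k : ℝ) - 1) '' (Set.Icc a b ×ˢ Set.univ)) := by
  have h : unitLift ((k : ℝ) - 1) '' (Set.Icc a b ×ˢ Set.univ) =
      unitLift ((k : ℝ) - 1) '' (Set.Icc a b ×ˢ Set.Icc 0 2) := by
    refine Set.Subset.antisymm ?_ (Set.image_mono (Set.prod_mono_right (Set.subset_univ _)))
    rintro _ ⟨⟨s, t⟩, ⟨hs, -⟩, rfl⟩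
    refine ⟨(s, t + 2 * (-⌊t / 2⌋ : ℤ)), ⟨hs, ?_⟩,
      Subtype.ext (lift_add_two_mul_int_snd k s t _)⟩
    have h1 := Int.floor_le (t / 2)
    have h2 := Int.lt_floor_add_one (t / 2)
    push_cast
    constructor <;> linarith
  rw [h]
  exact ((isCompact_Icc.prod isCompact_Icc).image (continuous_unitLift _)).isClosed

/-- The sign of `r` selects the hemisphere. Over a pole `cos φ = ±1`, so the hemisphere condition is
strict and survives a small change of `s`, while `sin φ` has an isolated zero; nearby points
therefore lie on the section over the same hemisphere. -/
theorem unitLift_mem_closure {k : ℕ} (hk : Even k) {r : ℝ} (hr : r ≠ 0) {x : ℝ × ℝ}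
    (hx : 0 ≤ r * Real.cos (2 * Real.pi * x.1)) :
    unitLift ((k : ℝ) - 1) x ∈ closure (section_ k '' {p | 0 ≤ r * (p : E3) 2}) := by
  by_cases h : Real.sin (2 * Real.pi * x.1) = 0
  · have hc : Real.cos (2 * Real.pi * x.1) ≠ 0 := by
      intro hc
      have := Real.sin_sq_add_cos_sq (2 * Real.pi * x.1)
      rw [h, hc] at this
      norm_num at this
    have hpos : 0 < r * Real.cos (2 * Real.pi * x.1) := hx.lt_of_ne (mul_ne_zero hr hc).symm
    have hd : HasDerivAt (fun s => Real.sin (2 * Real.pi * s))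
        (2 * Real.pi * Real.cos (2 * Real.pi * x.1)) x.1 := hasDerivAt_sin_const_mul _ _
    have h1 : ∀ᶠ s in 𝓝[≠] x.1, Real.sin (2 * Real.pi * s) ≠ 0 :=
      hd.eventually_ne (mul_ne_zero Real.two_pi_pos.ne' hc)
    have h2 : ∀ᶠ s in 𝓝[≠] x.1, 0 < r * Real.cos (2 * Real.pi * s) := by
      have hcont : Continuous fun s => r * Real.cos (2 * Real.pi * s) := by fun_prop
      exact (hcont.continuousAt.eventually (lt_mem_nhds hpos)).filter_mono nhdsWithin_le_nhds
    have ht : Filter.Tendsto (fun s => unitLift ((k : ℝ) - 1) (s, x.2)) (𝓝[≠] x.1)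
        (𝓝 (unitLift ((k : ℝ) - 1) x)) :=
      (((continuous_unitLift _).comp (Continuous.prodMk_left x.2)).tendsto x.1).mono_left
        nhdsWithin_le_nhds
    refine mem_closure_of_tendsto ht ?_
    filter_upwards [h1, h2] with s hs1 hs2
    obtain ⟨p, hp, hp2⟩ := exists_section_eq_unitLift hk (s, x.2) hs1
    exact ⟨p, by simpa only [Set.mem_ofPred_eq, hp2] using hs2.le, hp⟩
  · obtain ⟨p, hp, hp2⟩ := exists_section_eq_unitLift hk x h
    exact subset_closure ⟨p, by simpa only [Set.mem_ofPred_eq, hp2] using hx, hp⟩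

theorem range_kleinMap_incl₁ {k : ℕ} (hk : Even k) :
    Set.range (kleinMap hk ∘ MobiusBand.incl₁) =
      unitLift ((k : ℝ) - 1) '' (Set.Icc (-(1 / 4)) (1 / 4) ×ˢ Set.univ) := by
  ext q
  constructor
  · rintro ⟨⟨a, ha⟩, rfl⟩
    exact ⟨a, ⟨abs_le.1 ha, trivial⟩, rfl⟩
  · rintro ⟨a, ⟨ha, -⟩, rfl⟩
    exact ⟨Quotient.mk mobiusSetoid ⟨a, abs_le.2 ha⟩, rfl⟩

theorem range_kleinMap_incl₂ {k : ℕ} (hk : Even k) :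
    Set.range (kleinMap hk ∘ MobiusBand.incl₂) =
      unitLift ((k : ℝ) - 1) '' (Set.Icc (1 / 4) (3 / 4) ×ˢ Set.univ) := by
  ext q
  constructor
  · rintro ⟨⟨a, ha⟩, rfl⟩
    have ha' := abs_le.1 ha
    exact ⟨(a.1 + 1 / 2, a.2), ⟨⟨by dsimp only; linarith, by dsimp only; linarith⟩, trivial⟩, rfl⟩
  · rintro ⟨a, ⟨ha, -⟩, rfl⟩
    refine ⟨Quotient.mk mobiusSetoid ⟨(a.1 - 1 / 2, a.2),
      abs_le.2 ⟨by dsimp only; linarith [ha.1], by dsimp only; linarith [ha.2]⟩⟩, ?_⟩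
    change unitLift _ (a.1 - 1 / 2 + 1 / 2, a.2) = _
    rw [sub_add_cancel]

theorem range_kleinMap_incl₁_eq_closure {k : ℕ} (hk : Even k) :
    Set.range (kleinMap hk ∘ MobiusBand.incl₁) =
      closure (section_ k '' {p | 0 ≤ (p : E3) 2}) := by
  have hpi := Real.pi_pos
  rw [range_kleinMap_incl₁]
  refine Set.Subset.antisymm ?_ (closure_minimal ?_ (isClosed_unitLift_image k _ _))
  · rintro _ ⟨x, ⟨hx, -⟩, rfl⟩
    have h : 0 ≤ 1 * Real.cos (2 * Real.pi * x.1) := by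
      rw [one_mul]
      exact Real.cos_nonneg_of_neg_pi_div_two_le_of_le (by nlinarith [hx.1]) (by nlinarith [hx.2])
    simpa only [one_mul] using unitLift_mem_closure hk one_ne_zero h
  · rintro _ ⟨p, hp, rfl⟩
    obtain ⟨x, hx, h0, h1, h2⟩ := exists_unitLift_eq_section k p
    refine ⟨x, ⟨⟨by linarith, ?_⟩, trivial⟩, hx⟩
    -- On `[0, 1/2]`, a value `s > 1/4` would put `2πs` in `(π/2, π]`, where the cosine is negative.
    by_contra! hlt
    have := Real.cos_neg_of_pi_div_two_lt_of_lt (x := 2 * Real.pi * x.1)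
      (by nlinarith) (by nlinarith)
    rw [h2] at this
    exact absurd hp (not_le.2 this)

theorem range_kleinMap_incl₂_eq_closure {k : ℕ} (hk : Even k) :
    Set.range (kleinMap hk ∘ MobiusBand.incl₂) =
      closure (section_ k '' {p | (p : E3) 2 ≤ 0}) := by
  have hpi := Real.pi_pos
  rw [range_kleinMap_incl₂]
  refine Set.Subset.antisymm ?_ (closure_minimal ?_ (isClosed_unitLift_image k _ _))
  · rintro _ ⟨x, ⟨hx, -⟩, rfl⟩
    have h : 0 ≤ -1 * Real.cos (2 * Real.pi * x.1) := by
      have := Real.cos_nonpos_of_pi_div_two_le_of_le (x := 2 * Real.pi * x.1)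
        (by nlinarith [hx.1]) (by nlinarith [hx.2])
      linarith
    simpa only [neg_one_mul, Left.nonneg_neg_iff] using
      unitLift_mem_closure hk (neg_ne_zero.2 one_ne_zero) h
  · rintro _ ⟨p, hp, rfl⟩
    obtain ⟨x, hx, h0, h1, h2⟩ := exists_unitLift_eq_section k p
    refine ⟨x, ⟨⟨?_, by linarith⟩, trivial⟩, hx⟩
    by_contra! hlt
    have := Real.cos_pos_of_mem_Ioo (x := 2 * Real.pi * x.1)
      ⟨by nlinarith, by nlinarith⟩
    rw [h2] at this
    exact absurd hp (not_le.2 this)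

theorem range_kleinMap_eq_closure {k : ℕ} (hk : Even k) :
    Set.range (kleinMap hk) = closure (Set.range (section_ k)) := by
  have h : {p : PuncturedSphere | 0 ≤ (p : E3) 2} ∪ {p : PuncturedSphere | (p : E3) 2 ≤ 0} =
      Set.univ := Set.eq_univ_of_forall fun p => le_total 0 ((p : E3) 2)
  rw [← Set.image_univ, ← MobiusBand.range_union, Set.image_union, ← Set.range_comp,
    ← Set.range_comp, range_kleinMap_incl₁_eq_closure, range_kleinMap_incl₂_eq_closure,
    ← closure_union, ← Set.image_union, h, Set.image_univ]

end KleinField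

end

theorem theorem1p2 (k : ℕ) (hk : Even k) (hk2 : 2 < k) :
    ∃ f : KleinField.KleinBottle → KleinField.UnitTangentSphere,
      KleinField.IsMinimalImmersion f ∧
      Set.range f = closure (Set.range (KleinField.section_ k)) ∧
      Set.range (f ∘ KleinField.MobiusBand.incl₁) =
        closure (KleinField.section_ k '' {p | 0 ≤ (p : KleinField.E3) 2}) ∧
      Set.range (f ∘ KleinField.MobiusBand.incl₂) =
        closure (KleinField.section_ k '' {p | (p : KleinField.E3) 2 ≤ 0}) :=
  ⟨KleinField.kleinMap hk, KleinField.isMinimalImmersion_kleinMap hk hk2,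
    KleinField.range_kleinMap_eq_closure hk, KleinField.range_kleinMap_incl₁_eq_closure hk,
    KleinField.range_kleinMap_incl₂_eq_closure hk⟩
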